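/- (Unitary extension principle in the nonstationary setting.) Write $\widehat f(\xi)=\int_{\mathbb R} f(x)e^{-2\pi i\xi x}\,dx$ for the Fourier transform on $L_2(\mathbb R)$ (extended from nice functions to $L_2(\mathbb R)$ by Plancherel's theorem); all pointwise identities and limits in $\xi$ below are understood for almost every $\xi\in\mathbb R$. Let $\varphi_j\in L_2(\mathbb R)$, $j=0,1,2,\dots$, be such that $$\lim_{j\to\infty}2^{j/2}\,\widehat{\varphi_j}(\xi)=1 .$$ For each $j\ge 1$ let $m_{0,j}:\mathbb R\to\mathbb C$ be a $1$-periodic function, square-integrable over a period, such that $$|m_{0,j}(\xi)|^2+|m_{0,j}(\xi+1/2)|^2=2 ,$$ and suppose that for all $j\ge 0$ $$\widehat{\varphi_j}(\xi)=m_{0,j+1}\bigl(\xi/2^{j+1}\bigr)\,\widehat{\varphi_{j+1}}(\xi).$$ Put $m_{1,j}(\xi)=e^{2\pi i\xi}\,\overline{m_{0,j}(\xi+1/2)}$. Then there is a unique sequence of functions $\psi_j\in L_2(\mathbb R)$, $j\ge 0$, with $$\widehat{\psi_j}(\xi)=m_{1,j+1}\bigl(\xi/2^{j+1}\bigr)\,\widehat{\varphi_{j+1}}(\xi),$$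 and the family $$\{\varphi_0(\cdot-k):\ k\in\mathbb Z\}\ \cup\ \{\psi_j(\cdot-2^{-j}k):\ j\ge 0,\ k\in\mathbb Z\}$$ (indexed by the parameters $k$ and $(j,k)$) is a Parseval frame for $L_2(\mathbb R)$; that is, for every $f\in L_2(\mathbb R)$, $$\sum_{k\in\mathbb Z}|(f,\varphi_0(\cdot-k))|^2+\sum_{j\ge 0}\sum_{k\in\mathbb Z}|(f,\psi_j(\cdot-2^{-j}k))|^2=\|f\|^2 .$$ -/

import Mathlib

open MeasureTheory Filter Topology
open scoped FourierTransform ComplexConjugate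

noncomputable section

/-- The complex Hilbert space `L₂(ℝ)`. -/
abbrev LTwo : Type := Lp (α := ℝ) ℂ 2 volume

/-- A family `e` in a Hilbert space `H` is a Parseval frame if
`∑ᵢ |(f, eᵢ)|² = ‖f‖²` for every `f ∈ H`. -/
def IsParsevalFrame {ι H : Type*} [NormedAddCommGroup H] [InnerProductSpace ℂ H]
    (e : ι → H) : Prop :=
  ∀ f : H, HasSum (fun i => ‖inner ℂ (e i) f‖ ^ 2) (‖f‖ ^ 2)

/-- The shift `f_{j,k}(x) = f(x - 2^{-j} k)` of `f ∈ L₂(ℝ)`. -/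
def shift (f : LTwo) (j : ℕ) (k : ℤ) : LTwo :=
  Lp.compMeasurePreserving (fun x : ℝ => x - (k : ℝ) / 2 ^ j)
    (measurePreserving_sub_right volume ((k : ℝ) / 2 ^ j)) f

/-- The nonstationary wavelet system `{φ_{0,k}, ψ_{j,k} : j ∈ ℕ, k ∈ ℤ}`, where
`φ_{0,k}(x) = φ₀(x - k)` and `ψ_{j,k}(x) = ψ_j(x - 2^{-j} k)`. -/
def waveletSystem (φ₀ : LTwo) (ψ : ℕ → LTwo) : ℤ ⊕ (ℕ × ℤ) → LTwo :=
  Sum.elim (fun k => shift φ₀ 0 k) (fun p => shift (ψ p.1) p.1 p.2)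

/-- The wavelet mask `m₁(ξ) = e^{2πiξ} conj (m₀(ξ + 1/2))` of a scaling mask `m₀`. -/
def waveletMask (m₀ : ℝ → ℂ) (ξ : ℝ) : ℂ :=
  Complex.exp (2 * Real.pi * Complex.I * ξ) * conj (m₀ (ξ + 1 / 2))

/-- `ψ_j ∈ L₂(ℝ)` are the wavelet functions of the scaling functions `φ_j` and the scaling masks
`m_{0,j}`: for every `j`, `ψ̂_j(ξ) = m_{1,j+1}(ξ / 2^{j+1}) φ̂_{j+1}(ξ)` for almost every `ξ`. -/
def IsWaveletSequence (φ : ℕ → LTwo) (m₀ : ℕ → ℝ → ℂ) (ψ : ℕ → LTwo) : Prop :=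
  ∀ j : ℕ, ∀ᵐ ξ : ℝ,
    (𝓕 (ψ j) : LTwo) ξ = waveletMask (m₀ (j + 1)) (ξ / 2 ^ (j + 1)) * (𝓕 (φ (j + 1)) : LTwo) ξ

end

/-! Let S_j and W_j be the sums over k of |(f, φ_j(· - 2^{-j}k))|² and |(f, ψ_j(· - 2^{-j}k))|². For
band-limited f, Plancherel and Parseval for Fourier series turn S_j into 2^j times the integral over
a cell of length 2^j of the squared modulus of the 2^j-periodization of conj(φ̂_j) f̂, and likewise
W_j (`hasSum_sq_inner_shift`). The masks at ξ/2^{j+1} have period 2^{j+1}, and moving ξ by 2^j moves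
their argument by 1/2, so the unitarity of the mask matrix up to √2 (`paraunitary_identity`) gives
S_j + W_j = S_{j+1} (`integral_periodize_refinement`).

The sum of the W_j telescopes, and S_j → ‖f‖² by dominated convergence
(`tendsto_two_pow_mul_integral_periodize`), with the domination from `norm_le_one_of_refinement`.
Band-limited functions are dense, and the Parseval identity extends from a dense set
(`isParsevalFrame_of_dense`). -/

/-! ### Fourier transform of translates. -/

theorem SchwartzMap.fourier_compSubConst (h : SchwartzMap ℝ ℂ) (a ξ : ℝ) :
    𝓕 (SchwartzMap.compSubConstCLM ℂ a h) ξ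
      = Complex.exp (-(2 * Real.pi * Complex.I * ξ * a)) * 𝓕 h ξ := by
  rw [SchwartzMap.fourier_coe, SchwartzMap.fourier_coe, Real.fourier_real_eq_integral_exp_smul,
    Real.fourier_real_eq_integral_exp_smul, ← integral_const_mul]
  rw [← integral_add_right_eq_self _ a]
  congr 1 with x
  simp only [SchwartzMap.compSubConstCLM_apply, add_sub_cancel_right, smul_eq_mul]
  rw [← mul_assoc, ← Complex.exp_add]
  congr 2
  push_cast
  ring

theorem memLp_top_exp_mul (a : ℝ) :
    MemLp (fun ξ : ℝ => Complex.exp (-(2 * Real.pi * Complex.I * ξ * a))) ⊤ volume := by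
  refine memLp_top_of_bound (by fun_prop) 1 (ae_of_all _ fun ξ => ?_)
  rw [Complex.norm_exp]
  simp

/-- Translation by `a` becomes multiplication by `e^{-2πiξa}` under the `L²` Fourier transform. -/
theorem fourier_compSub_ae_eq (f : LTwo) (a : ℝ) :
    (𝓕 (Lp.compMeasurePreserving (fun x : ℝ => x - a) (measurePreserving_sub_right volume a) f :
      LTwo) : LTwo) =ᵐ[volume]
      fun ξ => Complex.exp (-(2 * Real.pi * Complex.I * ξ * a)) * (𝓕 f : LTwo) ξ := by
  -- Multiplication by the character as a bounded operator: both sides are then continuous in f, so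
  -- Schwartz functions suffice.
  let M : LTwo →L[ℂ] LTwo :=
    (ContinuousLinearMap.mul ℂ ℂ).holderL volume ⊤ 2 2 (memLp_top_exp_mul a).toLp
  have hM : ∀ g : LTwo, M g =ᵐ[volume]
      fun ξ => Complex.exp (-(2 * Real.pi * Complex.I * ξ * a)) * g ξ := by
    intro g
    have h1 := (ContinuousLinearMap.mul ℂ ℂ).coeFn_holder (r := 2) (memLp_top_exp_mul a).toLp g
    filter_upwards [h1, (memLp_top_exp_mul a).coeFn_toLp] with ξ h1 h2
    rw [← h2]
    exact h1
  suffices h : (𝓕 (Lp.compMeasurePreserving (fun x : ℝ => x - a)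
      (measurePreserving_sub_right volume a) f : LTwo) : LTwo) = M (𝓕 f : LTwo) by
    rw [h]; exact hM _
  refine DenseRange.induction_on (SchwartzMap.denseRange_toLpCLM (F := ℂ) (p := 2) (μ := volume)
    ENNReal.ofNat_ne_top) f ?_ ?_
  · refine isClosed_eq ?_ (M.continuous.comp (Lp.fourierTransformₗᵢ ℝ ℂ).continuous)
    exact (Lp.fourierTransformₗᵢ ℝ ℂ).continuous.comp
      (Lp.compMeasurePreservingₗᵢ ℂ _ (measurePreserving_sub_right volume a)).continuous
  · intro h
    have h1 : (Lp.compMeasurePreserving (fun x : ℝ => x - a)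
        (measurePreserving_sub_right volume a) (h.toLp 2) : LTwo)
        = (SchwartzMap.compSubConstCLM ℂ a h).toLp 2 := by
      apply Lp.ext
      refine (Lp.coeFn_compMeasurePreserving _ _).trans ?_
      have := (measurePreserving_sub_right volume a).quasiMeasurePreserving.ae_eq_comp
        (h.coeFn_toLp 2)
      refine this.trans ?_
      filter_upwards [(SchwartzMap.compSubConstCLM ℂ a h).coeFn_toLp 2] with x hx
      rw [hx]
      simp
    rw [SchwartzMap.toLpCLM_apply, h1, SchwartzMap.toLp_fourier_eq, SchwartzMap.toLp_fourier_eq]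
    apply Lp.ext
    filter_upwards [SchwartzMap.coeFn_toLp (𝓕 (SchwartzMap.compSubConstCLM ℂ a h)) 2, hM _,
      SchwartzMap.coeFn_toLp (𝓕 h) 2] with ξ h1 h2 h3
    rw [h1, h2, h3, SchwartzMap.fourier_compSubConst]

theorem fourier_shift_ae_eq (f : LTwo) (j : ℕ) (k : ℤ) :
    (𝓕 (shift f j k) : LTwo) =ᵐ[volume] fun ξ =>
      Complex.exp (-(2 * Real.pi * Complex.I * k * ξ / (2 ^ j : ℝ))) * (𝓕 f : LTwo) ξ := by
  filter_upwards [fourier_compSub_ae_eq f (k / 2 ^ j)] with ξ h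
  rw [shift, h]
  congr 3
  push_cast
  ring

/-! ### Extension from a dense set. -/

/-- Finite partial sums are continuous in f, so Bessel's inequality passes to all of H. The analysis
operator T into ℓ² is therefore bounded, which makes ‖T f‖² = ‖f‖² a closed condition. -/
theorem isParsevalFrame_of_dense {ι H : Type*} [NormedAddCommGroup H] [InnerProductSpace ℂ H]
    (e : ι → H) {D : Set H} (hD : Dense D)
    (h : ∀ f ∈ D, HasSum (fun i => ‖inner ℂ (e i) f‖ ^ 2) (‖f‖ ^ 2)) : IsParsevalFrame e := by
  have bessel : ∀ (s : Finset ι) (f : H), ∑ i ∈ s, ‖inner ℂ (e i) f‖ ^ 2 ≤ ‖f‖ ^ 2 := by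
    intro s
    refine hD.induction (fun f hf => ?_) (isClosed_le (by fun_prop) (by fun_prop))
    exact sum_le_hasSum s (fun i _ => by positivity) (h f hf)
  have hsum : ∀ f : H, Summable fun i => ‖inner ℂ (e i) f‖ ^ 2 := fun f =>
    summable_of_sum_le (fun i => by positivity) fun s => bessel s f
  have hmem : ∀ f : H, Memℓp (fun i => inner ℂ (e i) f) 2 := fun f =>
    memℓp_gen (by simpa using hsum f)
  let T : H →ₗ[ℂ] lp (fun _ : ι => ℂ) 2 :=
    { toFun := fun f => ⟨fun i => inner ℂ (e i) f, hmem f⟩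
      map_add' := fun f g => by ext i; exact inner_add_right _ _ _
      map_smul' := fun c f => by ext i; exact inner_smul_right _ _ _ }
  have hT : ∀ f, ‖T f‖ ^ 2 = ∑' i, ‖inner ℂ (e i) f‖ ^ 2 := by
    intro f
    have := lp.norm_rpow_eq_tsum (p := 2) (by simp) (T f)
    simpa [T] using this
  have hle : ∀ f, ‖T f‖ ≤ 1 * ‖f‖ := by
    intro f
    rw [one_mul]
    refine le_of_sq_le_sq ?_ (norm_nonneg _)
    rw [hT]
    exact (hsum f).tsum_le_of_sum_le fun s => bessel s f
  have hcont : Continuous T := (T.mkContinuous 1 hle).continuous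
  have heq : ∀ f, ‖T f‖ ^ 2 = ‖f‖ ^ 2 := by
    refine hD.induction (fun f hf => ?_) (isClosed_eq (by fun_prop) (by fun_prop))
    rw [hT, (h f hf).tsum_eq]
  intro f
  rw [← heq f, hT]
  exact (hsum f).hasSum

/-! ### Periodization and Parseval for Fourier series. -/

/-- The sum of the first `K` translates `G (ξ + k T)`, `0 ≤ k < K`. -/
def periodize (G : ℝ → ℂ) (T : ℝ) (K : ℕ) (ξ : ℝ) : ℂ :=
  ∑ k ∈ Finset.range K, G (ξ + k * T)

theorem MeasureTheory.MemLp.periodize {G : ℝ → ℂ} (hG : MemLp G 2 volume) (T : ℝ) (K : ℕ) :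
    MemLp (periodize G T K) 2 volume :=
  memLp_finsetSum (Finset.range K) (f := fun (k : ℕ) (ξ : ℝ) => G (ξ + k * T)) fun k _ =>
    hG.comp_measurePreserving (measurePreserving_add_right volume ((k : ℝ) * T))

theorem periodize_two_mul (G : ℝ → ℂ) (T : ℝ) (K : ℕ) (ξ : ℝ) :
    periodize G T (2 * K) ξ = periodize G (2 * T) K ξ + periodize G (2 * T) K (ξ + T) := by
  induction K with
  | zero => simp [periodize]
  | succ K ih =>
    simp only [periodize] at ih ⊢
    rw [show 2 * (K + 1) = 2 * K + 1 + 1 by ring, Finset.sum_range_succ, Finset.sum_range_succ, ih,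
      Finset.sum_range_succ, Finset.sum_range_succ]
    have h1 : ξ + ((2 * K : ℕ) : ℝ) * T = ξ + K * (2 * T) := by push_cast; ring
    have h2 : ξ + ((2 * K + 1 : ℕ) : ℝ) * T = ξ + T + K * (2 * T) := by push_cast; ring
    rw [h1, h2]
    ring

/-- The support is cut into K cells of length T; the exponential is T-periodic, so all cells fold
onto the first. -/
theorem integral_exp_mul_eq_periodize {G : ℝ → ℂ} (hG : MemLp G 2 volume) {T a : ℝ} (hT : 0 < T)
    {K : ℕ} (hsupp : ∀ᵐ ξ : ℝ, ξ ∉ Set.Ioc a (a + K * T) → G ξ = 0) (n : ℤ) :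
    ∫ ξ : ℝ, Complex.exp (2 * Real.pi * Complex.I * n * ξ / T) * G ξ
      = ∫ ξ : ℝ in a..a + T, Complex.exp (2 * Real.pi * Complex.I * n * ξ / T) * periodize G T K ξ := by
  set E : ℝ → ℂ := fun ξ => Complex.exp (2 * Real.pi * Complex.I * n * ξ / T) with hE
  have hEnorm : ∀ ξ, ‖E ξ‖ = 1 := by
    intro ξ
    rw [hE]
    simp only
    rw [Complex.norm_exp]
    have : (2 * Real.pi * Complex.I * n * ξ / T : ℂ)
        = ((2 * Real.pi * n * ξ / T : ℝ) : ℂ) * Complex.I := by push_cast; ring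
    rw [this]
    simp
  have hEG : MemLp (fun ξ => E ξ * G ξ) 2 volume :=
    hG.of_le ((by fun_prop : Continuous E).aestronglyMeasurable.mul hG.1)
      (ae_of_all _ fun ξ => by rw [norm_mul, hEnorm, one_mul])
  have hint : ∀ b c : ℝ, IntervalIntegrable (fun ξ => E ξ * G ξ) volume b c := fun b c =>
    ⟨(hEG.restrict _).integrable (by norm_num), (hEG.restrict _).integrable (by norm_num)⟩
  have hper : ∀ (k : ℕ) (ξ : ℝ), E (ξ + k * T) = E ξ := by
    intro k ξ
    simp only [hE]
    rw [Complex.exp_eq_exp_iff_exists_int]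
    refine ⟨n * k, ?_⟩
    have : (T : ℂ) ≠ 0 := by exact_mod_cast hT.ne'
    push_cast
    field_simp
  have hKT : a ≤ a + K * T := by
    have : 0 ≤ (K : ℝ) * T := by positivity
    linarith
  calc ∫ ξ, E ξ * G ξ = ∫ ξ in Set.Ioc a (a + K * T), E ξ * G ξ := by
        refine (setIntegral_eq_integral_of_ae_compl_eq_zero ?_).symm
        filter_upwards [hsupp] with ξ h hξ
        rw [h hξ, mul_zero]
    _ = ∫ ξ in (a + (0 : ℕ) * T)..(a + K * T), E ξ * G ξ := by
        rw [intervalIntegral.integral_of_le (by simpa using hKT)]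
        simp
    _ = ∑ k ∈ Finset.range K, ∫ ξ in (a + k * T)..(a + (k + 1 : ℕ) * T), E ξ * G ξ :=
        (intervalIntegral.sum_integral_adjacent_intervals (a := fun k : ℕ => a + k * T)
          fun k _ => hint _ _).symm
    _ = ∑ k ∈ Finset.range K, ∫ ξ in a..a + T, E ξ * G (ξ + k * T) := by
        refine Finset.sum_congr rfl fun k _ => ?_
        have := intervalIntegral.integral_comp_add_right (a := a) (b := a + T)
          (fun ξ => E ξ * G ξ) ((k : ℝ) * T)
        simp only [hper] at this
        rw [this]
        congr 1
        push_cast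
        ring
    _ = ∫ ξ in a..a + T, ∑ k ∈ Finset.range K, E ξ * G (ξ + k * T) := by
        refine (intervalIntegral.integral_finsetSum fun k _ => ?_).symm
        have h1 : MemLp (fun ξ => E (ξ + k * T) * G (ξ + k * T)) 2 volume :=
          hEG.comp_measurePreserving (measurePreserving_add_right volume ((k : ℝ) * T))
        simp only [hper] at h1
        exact ⟨(h1.restrict _).integrable (by norm_num), (h1.restrict _).integrable (by norm_num)⟩
    _ = _ := by simp only [periodize, Finset.mul_sum, hE]

theorem hasSum_sq_integral_exp_mul {G : ℝ → ℂ} (hG : MemLp G 2 volume) {T a : ℝ} (hT : 0 < T)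
    {K : ℕ} (hsupp : ∀ᵐ ξ : ℝ, ξ ∉ Set.Ioc a (a + K * T) → G ξ = 0) :
    HasSum (fun n : ℤ => ‖∫ ξ : ℝ, Complex.exp (2 * Real.pi * Complex.I * n * ξ / T) * G ξ‖ ^ 2)
      (T * ∫ ξ in a..a + T, ‖periodize G T K ξ‖ ^ 2) := by
  have hab : a < a + T := by linarith
  -- Fourier coefficients carry a factor 1/T, undone by T², and the opposite sign in the exponent,
  -- undone by n ↦ -n.
  have h := (hasSum_sq_fourierCoeffOn hab ((hG.periodize T K).restrict _)).mul_left (T ^ 2)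
  rw [← (Equiv.neg ℤ).hasSum_iff] at h
  have e1 : T ^ 2 * ((a + T - a)⁻¹ • ∫ ξ in a..a + T, ‖periodize G T K ξ‖ ^ 2)
      = T * ∫ ξ in a..a + T, ‖periodize G T K ξ‖ ^ 2 := by
    rw [add_sub_cancel_left, smul_eq_mul]
    field_simp
  rw [e1] at h
  refine Eq.mpr (congrArg (HasSum · _) (funext fun n => ?_)) h
  simp only [Function.comp_apply, Equiv.neg_apply]
  rw [fourierCoeffOn_eq_integral, integral_exp_mul_eq_periodize hG hT hsupp, neg_neg, norm_smul,
    mul_pow]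
  simp only [fourier_coe_apply, add_sub_cancel_left, smul_eq_mul]
  rw [Real.norm_of_nonneg (by positivity), one_div, inv_pow, mul_inv_cancel_left₀ (by positivity)]

theorem memLp_conj_mul_of_ae_le {g F : ℝ → ℂ} {C : ℝ} (hg : AEStronglyMeasurable g volume)
    (hF : MemLp F 2 volume) (hC : ∀ᵐ ξ : ℝ, ‖g ξ‖ ≤ C) :
    MemLp (fun ξ => conj (g ξ) * F ξ) 2 volume := by
  refine hF.of_le_mul (c := C) ((Complex.continuous_conj.comp_aestronglyMeasurable hg).mul hF.1) ?_
  filter_upwards [hC] with ξ h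
  rw [norm_mul, RCLike.norm_conj]
  gcongr

/-- By Plancherel the inner products are the Fourier integrals of conj(ĝ) f̂; the bound on ĝ keeps
this product in L². -/
theorem hasSum_sq_inner_shift {g f : LTwo} (j : ℕ) {C a : ℝ} (hg : ∀ᵐ ξ : ℝ, ‖(𝓕 g : LTwo) ξ‖ ≤ C)
    {K : ℕ} (hf : ∀ᵐ ξ : ℝ, ξ ∉ Set.Ioc a (a + K * 2 ^ j) → (𝓕 f : LTwo) ξ = 0) :
    HasSum (fun k : ℤ => ‖inner ℂ (shift g j k) f‖ ^ 2)
      (2 ^ j * ∫ ξ in a..a + 2 ^ j,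
        ‖periodize (fun ξ => conj ((𝓕 g : LTwo) ξ) * (𝓕 f : LTwo) ξ) (2 ^ j) K ξ‖ ^ 2) := by
  have hG : MemLp (fun ξ => conj ((𝓕 g : LTwo) ξ) * (𝓕 f : LTwo) ξ) 2 volume :=
    memLp_conj_mul_of_ae_le (Lp.aestronglyMeasurable _) (Lp.memLp _) hg
  have h := hasSum_sq_integral_exp_mul hG (T := 2 ^ j) (by positivity) (a := a) (K := K) (by
    filter_upwards [hf] with ξ h hξ
    rw [h hξ, mul_zero])
  refine Eq.mpr (congrArg (HasSum · _) (funext fun k => ?_)) h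
  congr 2
  rw [← Lp.inner_fourier_eq, L2.inner_def]
  refine integral_congr_ae ?_
  filter_upwards [fourier_shift_ae_eq g j k] with ξ hξ
  rw [hξ, RCLike.inner_apply, map_mul, ← Complex.exp_conj]
  simp only [map_neg, map_div₀, map_mul, Complex.conj_I, Complex.conj_ofReal, map_ofNat,
    map_intCast, Complex.ofReal_pow, Complex.ofReal_ofNat, map_pow]
  rw [mul_comm, mul_assoc]
  congr 2
  ring

/-! ### Masks and the energy splitting. -/

theorem quasiMeasurePreserving_div_const {c : ℝ} (hc : c ≠ 0) :
    Measure.QuasiMeasurePreserving (fun ξ : ℝ => ξ / c) volume volume := by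
  refine ⟨by fun_prop, ?_⟩
  simp only [div_eq_mul_inv]
  rw [Real.map_volume_mul_right (inv_ne_zero hc)]
  exact Measure.smul_absolutelyContinuous

theorem ae_comp_add {p : ℝ → Prop} (h : ∀ᵐ ξ : ℝ, p ξ) (d : ℝ) : ∀ᵐ ξ : ℝ, p (ξ + d) :=
  (measurePreserving_add_right volume d).quasiMeasurePreserving.ae h

theorem periodize_mul_ae_eq {G G' c : ℝ → ℂ} {T : ℝ} (hc : Function.Periodic c T)
    (h : ∀ᵐ ξ : ℝ, G' ξ = c ξ * G ξ) (K : ℕ) :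
    ∀ᵐ ξ : ℝ, periodize G' T K ξ = c ξ * periodize G T K ξ := by
  have h' : ∀ᵐ ξ : ℝ, ∀ k : ℕ, G' (ξ + k * T) = c (ξ + k * T) * G (ξ + k * T) :=
    ae_all_iff.2 fun k => ae_comp_add h _
  filter_upwards [h'] with ξ h
  simp only [periodize, Finset.mul_sum]
  refine Finset.sum_congr rfl fun k _ => ?_
  rw [h, hc.nat_mul k ξ]

theorem waveletMask_periodic {m : ℝ → ℂ} (hm : Function.Periodic m 1) :
    Function.Periodic (waveletMask m) 1 := by
  intro ξ
  have h1 : m (ξ + 1 + 1 / 2) = m (ξ + 1 / 2) := by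
    rw [← hm (ξ + 1 / 2)]; congr 1; ring
  have h2 : Complex.exp (2 * Real.pi * Complex.I * (ξ + 1 : ℝ))
      = Complex.exp (2 * Real.pi * Complex.I * ξ) := by
    rw [← Complex.exp_periodic (2 * Real.pi * Complex.I * ξ)]; congr 1; push_cast; ring
  rw [waveletMask, waveletMask, h1, h2]

theorem waveletMask_add_half {m : ℝ → ℂ} (hm : Function.Periodic m 1) (ξ : ℝ) :
    waveletMask m (ξ + 1 / 2) = -(Complex.exp (2 * Real.pi * Complex.I * ξ) * conj (m ξ)) := by
  have h1 : m (ξ + 1 / 2 + 1 / 2) = m ξ := by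
    rw [← hm ξ]; congr 1; ring
  have h2 : Complex.exp (2 * Real.pi * Complex.I * (ξ + 1 / 2 : ℝ))
      = -Complex.exp (2 * Real.pi * Complex.I * ξ) := by
    rw [← Complex.exp_add_pi_mul_I]; congr 1; push_cast; ring
  rw [waveletMask, h1, h2, neg_mul]

theorem norm_exp_two_pi_I_mul (ξ : ℝ) : ‖Complex.exp (2 * Real.pi * Complex.I * ξ)‖ = 1 := by
  rw [show (2 * Real.pi * Complex.I * ξ : ℂ) = ((2 * Real.pi * ξ : ℝ) : ℂ) * Complex.I by
    push_cast; ring, Complex.norm_exp_ofReal_mul_I]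

theorem norm_waveletMask (m : ℝ → ℂ) (ξ : ℝ) : ‖waveletMask m ξ‖ = ‖m (ξ + 1 / 2)‖ := by
  rw [waveletMask, norm_mul, norm_exp_two_pi_I_mul, one_mul, RCLike.norm_conj]

/-- Up to a unimodular factor, the two rows are (conj u, conj v) and (v, -u) with |u|² + |v|² = 2:
orthogonal, each of norm √2. -/
theorem paraunitary_identity {m : ℝ → ℂ} (hm : Function.Periodic m 1) {ξ : ℝ}
    (hmask : ‖m ξ‖ ^ 2 + ‖m (ξ + 1 / 2)‖ ^ 2 = 2) (A B : ℂ) :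
    ‖conj (m ξ) * A + conj (m (ξ + 1 / 2)) * B‖ ^ 2
      + ‖conj (waveletMask m ξ) * A + conj (waveletMask m (ξ + 1 / 2)) * B‖ ^ 2
      = 2 * (‖A‖ ^ 2 + ‖B‖ ^ 2) := by
  have h : conj (waveletMask m ξ) * A + conj (waveletMask m (ξ + 1 / 2)) * B
      = conj (Complex.exp (2 * Real.pi * Complex.I * ξ)) * (m (ξ + 1 / 2) * A - m ξ * B) := by
    rw [waveletMask_add_half hm, waveletMask]
    simp only [map_neg, map_mul, Complex.conj_conj]
    ring
  rw [h, norm_mul, RCLike.norm_conj, norm_exp_two_pi_I_mul, one_mul]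
  generalize m ξ = u at hmask ⊢
  generalize m (ξ + 1 / 2) = v at hmask ⊢
  rw [← hmask]
  apply Complex.ofReal_injective
  push_cast
  simp only [← Complex.conj_mul', map_add, map_sub, map_mul, Complex.conj_conj]
  ring

/-- The T-periodization is the 2T-periodization at ξ plus that at ξ + T; these serve as A and B in
`paraunitary_identity`, and the two half cells reassemble into one of length 2T. -/
theorem integral_periodize_refinement {m G G₀ G₁ : ℝ → ℂ} {T : ℝ} (hT : 0 < T) (a : ℝ) (K : ℕ)
    (hm : Function.Periodic m 1) (hmask : ∀ᵐ ξ : ℝ, ‖m ξ‖ ^ 2 + ‖m (ξ + 1 / 2)‖ ^ 2 = 2)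
    (hG : MemLp G 2 volume) (hG₀ : MemLp G₀ 2 volume) (hG₁ : MemLp G₁ 2 volume)
    (h₀ : ∀ᵐ ξ : ℝ, G₀ ξ = conj (m (ξ / (2 * T))) * G ξ)
    (h₁ : ∀ᵐ ξ : ℝ, G₁ ξ = conj (waveletMask m (ξ / (2 * T))) * G ξ) :
    T * (∫ ξ in a..a + T, ‖periodize G₀ T (2 * K) ξ‖ ^ 2)
      + T * (∫ ξ in a..a + T, ‖periodize G₁ T (2 * K) ξ‖ ^ 2)
      = 2 * T * ∫ ξ in a..a + 2 * T, ‖periodize G (2 * T) K ξ‖ ^ 2 := by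
  have hint : ∀ {H : ℝ → ℂ}, MemLp H 2 volume → ∀ b c : ℝ,
      IntervalIntegrable (fun ξ => ‖H ξ‖ ^ 2) volume b c := fun hH b c =>
    (hH.integrable_norm_pow two_ne_zero).intervalIntegrable
  have hper : ∀ {c : ℝ → ℂ}, Function.Periodic c 1 →
      Function.Periodic (fun ξ => conj (c (ξ / (2 * T)))) (2 * T) := by
    intro c hc ξ
    simp only
    rw [add_div, div_self (by positivity), hc]
  have hhalf : ∀ ξ : ℝ, (ξ + T) / (2 * T) = ξ / (2 * T) + 1 / 2 := by
    intro ξ; field_simp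
  have key : ∀ᵐ ξ : ℝ, ‖periodize G₀ T (2 * K) ξ‖ ^ 2 + ‖periodize G₁ T (2 * K) ξ‖ ^ 2
      = 2 * (‖periodize G (2 * T) K ξ‖ ^ 2 + ‖periodize G (2 * T) K (ξ + T)‖ ^ 2) := by
    have p₀ := periodize_mul_ae_eq (hper hm) h₀ K
    have p₁ := periodize_mul_ae_eq (hper (waveletMask_periodic hm)) h₁ K
    filter_upwards [p₀, p₁, ae_comp_add p₀ T, ae_comp_add p₁ T,
      (quasiMeasurePreserving_div_const (c := 2 * T) (by positivity)).ae hmask]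
      with ξ a₀ a₁ b₀ b₁ hξ
    rw [periodize_two_mul, periodize_two_mul, a₀, a₁, b₀, b₁, hhalf]
    exact paraunitary_identity hm hξ _ _
  have hP := hG.periodize (2 * T) K
  have hPT : MemLp (fun ξ => periodize G (2 * T) K (ξ + T)) 2 volume :=
    hP.comp_measurePreserving (measurePreserving_add_right volume T)
  rw [← mul_add, ← intervalIntegral.integral_add (hint (hG₀.periodize _ _) _ _)
    (hint (hG₁.periodize _ _) _ _), intervalIntegral.integral_congr_ae (key.mono fun ξ h _ => h),
    intervalIntegral.integral_const_mul, intervalIntegral.integral_add (hint hP _ _)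
    (hint hPT _ _), intervalIntegral.integral_comp_add_right
    (fun ξ => ‖periodize G (2 * T) K ξ‖ ^ 2) T, intervalIntegral.integral_add_adjacent_intervals
    (hint hP _ _) (hint hP _ _), show a + T + T = a + 2 * T by ring]
  ring

/-! ### Measurability of masks and density of band-limited functions. -/

theorem Function.Periodic.aestronglyMeasurable {m : ℝ → ℂ} (hm : Function.Periodic m 1)
    (h : AEStronglyMeasurable m (volume.restrict (Set.Ico (0 : ℝ) 1))) :
    AEStronglyMeasurable m volume := by
  have hcover : (⋃ n : ℤ, Set.Ico (n : ℝ) (n + 1)) = Set.univ := iUnion_Ico_intCast ℝ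
  rw [← Measure.restrict_univ (μ := volume), ← hcover, aestronglyMeasurable_iUnion_iff]
  intro n
  have hmp : MeasurePreserving (fun x : ℝ => x - n) (volume.restrict (Set.Ico (n : ℝ) (n + 1)))
      (volume.restrict (Set.Ico (0 : ℝ) 1)) := by
    have := (measurePreserving_sub_right volume (n : ℝ)).restrict_preimage
      (measurableSet_Ico (a := (0 : ℝ)) (b := 1))
    simpa [Set.preimage_sub_const_Ico, add_comm] using this
  refine (h.comp_measurePreserving hmp).congr (ae_of_all _ fun x => ?_)
  exact hm.sub_int_mul_eq n |> fun h => by simpa using h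

theorem dense_fourier_ae_eq_zero :
    Dense {f : LTwo | ∃ R : ℝ, ∀ᵐ ξ : ℝ, ξ ∉ Set.Ioc (-R) R → (𝓕 f : LTwo) ξ = 0} := by
  have hD : Dense {g : LTwo | ∃ R : ℝ, ∀ᵐ ξ : ℝ, ξ ∉ Set.Ioc (-R) R → g ξ = 0} := by
    rw [Metric.dense_iff]
    intro f r hr
    obtain ⟨g, hgs, hg, -, hgm⟩ := (Lp.memLp f).exists_hasCompactSupport_eLpNorm_sub_le
      ENNReal.ofNat_ne_top (ε := ENNReal.ofReal (r / 2)) (by simpa using hr)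
    refine ⟨hgm.toLp, ?_, ?_⟩
    · rw [Metric.mem_ball, dist_comm, Lp.dist_def]
      have : eLpNorm (⇑f - ⇑hgm.toLp) 2 volume ≤ ENNReal.ofReal (r / 2) := by
        refine (eLpNorm_congr_ae ?_).trans_le hg
        exact EventuallyEq.rfl.sub hgm.coeFn_toLp
      calc _ ≤ r / 2 := ENNReal.toReal_le_of_le_ofReal (by positivity) this
        _ < r := by linarith
    · obtain ⟨R, hR⟩ := hgs.isCompact.isBounded.subset_closedBall 0
      -- The extra 1 is needed because `Ioc` omits its left endpoint.
      refine ⟨R + 1, ?_⟩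
      filter_upwards [hgm.coeFn_toLp] with ξ h hξ
      rw [h]
      by_contra hne
      have h1 := hR (subset_tsupport g hne)
      rw [mem_closedBall_zero_iff, Real.norm_eq_abs] at h1
      have h2 := abs_le.1 h1
      exact hξ ⟨by linarith, by linarith⟩
  exact hD.preimage (Lp.fourierTransformₗᵢ ℝ ℂ).toHomeomorph.isOpenMap

/-! ### Mask bounds and existence of the wavelets. -/

theorem norm_le_sqrt_two_of_mask {m : ℝ → ℂ} {ξ : ℝ} (h : ‖m ξ‖ ^ 2 + ‖m (ξ + 1 / 2)‖ ^ 2 = 2) :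
    ‖m ξ‖ ≤ √2 ∧ ‖m (ξ + 1 / 2)‖ ≤ √2 :=
  ⟨Real.le_sqrt_of_sq_le (by nlinarith [sq_nonneg ‖m (ξ + 1 / 2)‖]),
    Real.le_sqrt_of_sq_le (by nlinarith [sq_nonneg ‖m ξ‖])⟩

theorem rpow_half_succ (j : ℕ) : (2 : ℝ) ^ (((j + 1 : ℕ) : ℝ) / 2) = √2 * 2 ^ ((j : ℝ) / 2) := by
  rw [Real.sqrt_eq_rpow, ← Real.rpow_add two_pos]
  congr 1
  push_cast
  ring

/-- Since |m₀| ≤ √2, the quantity is nondecreasing in j, hence bounded by its limit 1. -/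
theorem norm_le_one_of_refinement {Φ : ℕ → ℝ → ℂ} {m₀ : ℕ → ℝ → ℂ}
    (hlim : ∀ᵐ ξ : ℝ, Tendsto
      (fun j : ℕ => (((2 : ℝ) ^ ((j : ℝ) / 2) : ℝ) : ℂ) * Φ j ξ) atTop (𝓝 1))
    (hmask : ∀ j : ℕ, 1 ≤ j → ∀ᵐ ξ : ℝ, ‖m₀ j ξ‖ ^ 2 + ‖m₀ j (ξ + 1 / 2)‖ ^ 2 = 2)
    (href : ∀ j : ℕ, ∀ᵐ ξ : ℝ, Φ j ξ = m₀ (j + 1) (ξ / 2 ^ (j + 1)) * Φ (j + 1) ξ) :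
    ∀ᵐ ξ : ℝ, ∀ j : ℕ, (2 : ℝ) ^ ((j : ℝ) / 2) * ‖Φ j ξ‖ ≤ 1 := by
  have hm : ∀ᵐ ξ : ℝ, ∀ j : ℕ, ‖m₀ (j + 1) (ξ / 2 ^ (j + 1))‖ ≤ √2 := by
    refine ae_all_iff.2 fun j => ?_
    filter_upwards [(quasiMeasurePreserving_div_const (c := 2 ^ (j + 1)) (by positivity)).ae
      (hmask (j + 1) (by omega))] with ξ h
    exact (norm_le_sqrt_two_of_mask h).1
  filter_upwards [hlim, hm, ae_all_iff.2 href] with ξ hl hm hr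
  have hl' := hl.norm
  simp only [norm_mul, Complex.norm_real, norm_one] at hl'
  have hnn : ∀ j : ℕ, ‖(2 : ℝ) ^ ((j : ℝ) / 2)‖ = 2 ^ ((j : ℝ) / 2) := fun j =>
    Real.norm_of_nonneg (by positivity)
  simp only [hnn] at hl'
  have hmono : Monotone fun j : ℕ => (2 : ℝ) ^ ((j : ℝ) / 2) * ‖Φ j ξ‖ := by
    refine monotone_nat_of_le_succ fun j => ?_
    rw [rpow_half_succ, hr j, norm_mul]
    calc (2 : ℝ) ^ ((j : ℝ) / 2) * (‖m₀ (j + 1) (ξ / 2 ^ (j + 1))‖ * ‖Φ (j + 1) ξ‖)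
        ≤ (2 : ℝ) ^ ((j : ℝ) / 2) * (√2 * ‖Φ (j + 1) ξ‖) := by gcongr; exact hm j
      _ = _ := by ring
  exact fun j => hmono.ge_of_tendsto hl' j

theorem existsUnique_isWaveletSequence (φ : ℕ → LTwo) (m₀ : ℕ → ℝ → ℂ)
    (hper : ∀ j : ℕ, 1 ≤ j → Function.Periodic (m₀ j) 1)
    (hmem : ∀ j : ℕ, 1 ≤ j → MemLp (m₀ j) 2 (volume.restrict (Set.Ico (0 : ℝ) 1)))
    (hmask : ∀ j : ℕ, 1 ≤ j → ∀ᵐ ξ : ℝ, ‖m₀ j ξ‖ ^ 2 + ‖m₀ j (ξ + 1 / 2)‖ ^ 2 = 2) :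
    ∃! ψ : ℕ → LTwo, IsWaveletSequence φ m₀ ψ := by
  have hL2 : ∀ j : ℕ, MemLp (fun ξ : ℝ => waveletMask (m₀ (j + 1)) (ξ / 2 ^ (j + 1))
      * (𝓕 (φ (j + 1)) : LTwo) ξ) 2 volume := by
    intro j
    have hmeas := (hper (j + 1) (by omega)).aestronglyMeasurable (hmem (j + 1) (by omega)).1
    have hw : AEStronglyMeasurable (waveletMask (m₀ (j + 1))) volume := by
      refine AEStronglyMeasurable.mul (by fun_prop)
        (Complex.continuous_conj.comp_aestronglyMeasurable ?_)
      exact hmeas.comp_measurePreserving (measurePreserving_add_right volume (1 / 2 : ℝ))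
    have hq : Measure.QuasiMeasurePreserving (fun ξ : ℝ => ξ / 2 ^ (j + 1)) volume volume :=
      quasiMeasurePreserving_div_const (by positivity)
    refine (Lp.memLp (𝓕 (φ (j + 1)) : LTwo)).of_le_mul (c := √2)
      ((hw.comp_quasiMeasurePreserving hq).mul (Lp.aestronglyMeasurable _)) ?_
    filter_upwards [hq.ae (hmask (j + 1) (by omega))] with ξ h
    rw [norm_mul, norm_waveletMask]
    gcongr
    exact (norm_le_sqrt_two_of_mask h).2
  refine ⟨fun j => 𝓕⁻ (hL2 j).toLp, fun j => ?_, fun ψ hψ => funext fun j => ?_⟩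
  · rw [FourierTransform.fourier_fourierInv_eq]
    exact (hL2 j).coeFn_toLp
  · have h : (𝓕 (ψ j) : LTwo) = (hL2 j).toLp := Lp.ext <| by
      filter_upwards [hψ j, (hL2 j).coeFn_toLp] with ξ h1 h2
      rw [h1, h2]
    simp only [← h]
    exact ((Lp.fourierTransformₗᵢ ℝ ℂ).symm_apply_apply (ψ j)).symm

theorem ae_eq_zero_of_not_mem_Ioc {F : ℝ → ℂ} {R : ℝ}
    (hf : ∀ᵐ ξ : ℝ, ξ ∉ Set.Ioc (-R) R → F ξ = 0) {L : ℝ} (hL : 2 * R ≤ L) :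
    ∀ᵐ ξ : ℝ, ξ ∉ Set.Ioc (-R) (-R + L) → F ξ = 0 := by
  filter_upwards [hf] with ξ h hξ
  exact h fun h' => hξ ⟨h'.1, h'.2.trans (by linarith)⟩

theorem hasSum_sum_prod_of_nonneg {u : ℤ → ℝ} {v : ℕ → ℤ → ℝ} {s t : ℝ} {w : ℕ → ℝ}
    (hv : ∀ j k, 0 ≤ v j k) (hu : HasSum u s) (hvw : ∀ j, HasSum (v j) (w j)) (hw : HasSum w t) :
    HasSum (Sum.elim u fun p : ℕ × ℤ => v p.1 p.2) (s + t) := by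
  have hsum : Summable fun p : ℕ × ℤ => v p.1 p.2 := by
    refine (summable_prod_of_nonneg fun p => hv p.1 p.2).2 ⟨fun j => (hvw j).summable, ?_⟩
    simp only [fun j => (hvw j).tsum_eq]
    exact hw.summable
  have h := hsum.hasSum.prod_fiberwise hvw
  have ht : HasSum (fun p : ℕ × ℤ => v p.1 p.2) t := by
    rw [hw.unique h]
    exact hsum.hasSum
  refine HasSum.sum ?_ ?_
  · simpa [Function.comp_def] using hu
  · simpa [Function.comp_def] using ht

/-! ### Limit of the energies and conclusion. -/

/-- The `j`-th scaling energies of a band-limited `f` converge to `‖f‖²`. -/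
theorem tendsto_two_pow_mul_integral_periodize {Φ : ℕ → LTwo} (F : LTwo) {R : ℝ}
    (hlim : ∀ᵐ ξ : ℝ, Tendsto
      (fun j : ℕ => (((2 : ℝ) ^ ((j : ℝ) / 2) : ℝ) : ℂ) * Φ j ξ) atTop (𝓝 1))
    (hbd : ∀ᵐ ξ : ℝ, ∀ j : ℕ, (2 : ℝ) ^ ((j : ℝ) / 2) * ‖Φ j ξ‖ ≤ 1)
    (hf : ∀ᵐ ξ : ℝ, ξ ∉ Set.Ioc (-R) R → F ξ = 0) :
    Tendsto (fun j : ℕ => (2 : ℝ) ^ j * ∫ ξ in (-R)..(-R + 2 ^ j),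
      ‖periodize (fun ξ => conj (Φ j ξ) * F ξ) (2 ^ j) 1 ξ‖ ^ 2) atTop (𝓝 (‖F‖ ^ 2)) := by
  have hpow : ∀ j : ℕ, ((2 : ℝ) ^ ((j : ℝ) / 2)) ^ 2 = 2 ^ j := by
    intro j
    rw [← Real.rpow_natCast, ← Real.rpow_mul two_pos.le, ← Real.rpow_natCast]
    congr 1
    push_cast
    ring
  have hnorm : ‖F‖ ^ 2 = ∫ ξ, ‖F ξ‖ ^ 2 := by
    have h := L2.inner_def (𝕜 := ℂ) F F
    rw [inner_self_eq_norm_sq_to_K] at h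
    apply Complex.ofReal_injective
    rw [← integral_complex_ofReal]
    push_cast
    refine h.trans (integral_congr_ae (ae_of_all _ fun ξ => ?_))
    simp only
    rw [inner_self_eq_norm_sq_to_K]
    rfl
  rw [hnorm]
  have hconv : Tendsto (fun j : ℕ => ∫ ξ, ((2 : ℝ) ^ ((j : ℝ) / 2) * ‖Φ j ξ‖) ^ 2 * ‖F ξ‖ ^ 2)
      atTop (𝓝 (∫ ξ, ‖F ξ‖ ^ 2)) := by
    refine tendsto_integral_of_dominated_convergence (fun ξ => ‖F ξ‖ ^ 2) (fun j => ?_)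
      ((Lp.memLp F).integrable_norm_pow two_ne_zero) (fun j => ?_) ?_
    · exact (((Lp.aestronglyMeasurable (Φ j)).norm.const_mul _).pow 2).mul
        ((Lp.aestronglyMeasurable F).norm.pow 2)
    · filter_upwards [hbd] with ξ h
      rw [Real.norm_of_nonneg (by positivity)]
      exact mul_le_of_le_one_left (by positivity) (pow_le_one₀ (by positivity) (h j))
    · filter_upwards [hlim] with ξ h
      have h1 := (h.norm.pow 2).mul_const (‖F ξ‖ ^ 2)
      simp only [norm_mul, Complex.norm_real, norm_one, one_pow, one_mul] at h1
      refine h1.congr fun j => ?_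
      rw [Real.norm_of_nonneg (by positivity)]
  refine hconv.congr' ?_
  -- Once 2^j ≥ 2R a single cell contains the support, so `K = 1` loses nothing.
  obtain ⟨N, hN⟩ := pow_unbounded_of_one_lt (2 * R) (one_lt_two (α := ℝ))
  filter_upwards [eventually_ge_atTop N] with j hj
  have hL : 2 * R ≤ 2 ^ j := hN.le.trans (pow_le_pow_right₀ one_le_two hj)
  have hle : -R ≤ -R + 2 ^ j := by linarith [pow_pos (two_pos (α := ℝ)) j]
  rw [intervalIntegral.integral_of_le hle, ← integral_const_mul,
    ← setIntegral_eq_integral_of_ae_compl_eq_zero (s := Set.Ioc (-R) (-R + 2 ^ j))]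
  · refine integral_congr_ae (ae_of_all _ fun ξ => ?_)
    simp only [periodize, Finset.sum_range_one, Nat.cast_zero, zero_mul, add_zero]
    rw [mul_pow, hpow, norm_mul, RCLike.norm_conj]
    ring
  · filter_upwards [ae_eq_zero_of_not_mem_Ioc hf hL] with ξ h hξ
    rw [h hξ]
    simp

theorem hasSum_waveletSystem_of_bandlimited {φ ψ : ℕ → LTwo} {m₀ : ℕ → ℝ → ℂ}
    (hlim : ∀ᵐ ξ : ℝ, Tendsto
      (fun j : ℕ => (((2 : ℝ) ^ ((j : ℝ) / 2) : ℝ) : ℂ) * (𝓕 (φ j) : LTwo) ξ) atTop (𝓝 1))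
    (hper : ∀ j : ℕ, 1 ≤ j → Function.Periodic (m₀ j) 1)
    (hmask : ∀ j : ℕ, 1 ≤ j → ∀ᵐ ξ : ℝ, ‖m₀ j ξ‖ ^ 2 + ‖m₀ j (ξ + 1 / 2)‖ ^ 2 = 2)
    (href : ∀ j : ℕ, ∀ᵐ ξ : ℝ,
      (𝓕 (φ j) : LTwo) ξ = m₀ (j + 1) (ξ / 2 ^ (j + 1)) * (𝓕 (φ (j + 1)) : LTwo) ξ)
    (hψ : IsWaveletSequence φ m₀ ψ) {f : LTwo} {R : ℝ}
    (hf : ∀ᵐ ξ : ℝ, ξ ∉ Set.Ioc (-R) R → (𝓕 f : LTwo) ξ = 0) :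
    HasSum (fun i => ‖inner ℂ (waveletSystem (φ 0) ψ i) f‖ ^ 2) (‖f‖ ^ 2) := by
  have hbd := norm_le_one_of_refinement hlim hmask href
  have hφ : ∀ j, ∀ᵐ ξ : ℝ, ‖(𝓕 (φ j) : LTwo) ξ‖ ≤ 1 := by
    intro j
    filter_upwards [hbd] with ξ h
    refine le_trans ?_ (h j)
    exact le_mul_of_one_le_left (norm_nonneg _)
      (Real.one_le_rpow one_le_two (by positivity))
  have hψb : ∀ j, ∀ᵐ ξ : ℝ, ‖(𝓕 (ψ j) : LTwo) ξ‖ ≤ √2 := by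
    intro j
    filter_upwards [hψ j, hφ (j + 1), (quasiMeasurePreserving_div_const (c := 2 ^ (j + 1))
      (by positivity)).ae (hmask (j + 1) (by omega))] with ξ h1 h2 h3
    rw [h1, norm_mul, norm_waveletMask]
    exact (mul_le_of_le_one_right (norm_nonneg _) h2).trans (norm_le_sqrt_two_of_mask h3).2
  have hsupp : ∀ (K j : ℕ), 2 * R ≤ K * 2 ^ j →
      ∀ᵐ ξ : ℝ, ξ ∉ Set.Ioc (-R) (-R + K * 2 ^ j) → (𝓕 f : LTwo) ξ = 0 :=
    fun K j h => ae_eq_zero_of_not_mem_Ioc hf h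
  have hS : ∀ j, Summable fun k : ℤ => ‖inner ℂ (shift (φ j) j k) f‖ ^ 2 := fun j => by
    obtain ⟨K, hK⟩ := exists_nat_ge (2 * R)
    exact (hasSum_sq_inner_shift j (hφ j) (hsupp K j (hK.trans
      (le_mul_of_one_le_right (by positivity) (one_le_pow₀ one_le_two))))).summable
  have hW : ∀ j, Summable fun k : ℤ => ‖inner ℂ (shift (ψ j) j k) f‖ ^ 2 := fun j => by
    obtain ⟨K, hK⟩ := exists_nat_ge (2 * R)
    exact (hasSum_sq_inner_shift j (hψb j) (hsupp K j (hK.trans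
      (le_mul_of_one_le_right (by positivity) (one_le_pow₀ one_le_two))))).summable
  set S : ℕ → ℝ := fun j => ∑' k : ℤ, ‖inner ℂ (shift (φ j) j k) f‖ ^ 2 with hSdef
  set W : ℕ → ℝ := fun j => ∑' k : ℤ, ‖inner ℂ (shift (ψ j) j k) f‖ ^ 2 with hWdef
  have hstep : ∀ j, S j + W j = S (j + 1) := by
    intro j
    obtain ⟨K, hK⟩ := exists_nat_ge (2 * R)
    have hK1 : 2 * R ≤ K * 2 ^ (j + 1) :=
      hK.trans (le_mul_of_one_le_right (by positivity) (one_le_pow₀ one_le_two))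
    -- Level j uses 2K cells of length 2^j, covering the same interval as K cells at level j + 1.
    have hK0 : 2 * R ≤ (2 * K : ℕ) * 2 ^ j := by
      rw [pow_succ] at hK1
      push_cast
      linarith
    simp only [hSdef, hWdef]
    rw [(hasSum_sq_inner_shift j (hφ j) (hsupp _ _ hK0)).tsum_eq,
      (hasSum_sq_inner_shift j (hψb j) (hsupp _ _ hK0)).tsum_eq,
      (hasSum_sq_inner_shift (j + 1) (hφ (j + 1)) (hsupp _ _ hK1)).tsum_eq]
    have hmem : ∀ {g : LTwo} {C : ℝ}, (∀ᵐ ξ : ℝ, ‖(𝓕 g : LTwo) ξ‖ ≤ C) →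
        MemLp (fun ξ => conj ((𝓕 g : LTwo) ξ) * (𝓕 f : LTwo) ξ) 2 volume := fun h =>
      memLp_conj_mul_of_ae_le (Lp.aestronglyMeasurable _) (Lp.memLp _) h
    rw [pow_succ' (2 : ℝ) j]
    refine integral_periodize_refinement (m := m₀ (j + 1)) (by positivity) (-R) K
      (hper _ (by omega)) (hmask _ (by omega)) (hmem (hφ (j + 1))) (hmem (hφ j)) (hmem (hψb j))
      ?_ ?_
    · filter_upwards [href j] with ξ h
      rw [h, map_mul, mul_assoc, pow_succ']
    · filter_upwards [hψ j] with ξ h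
      rw [h, map_mul, mul_assoc, pow_succ']
  have hlimS : Tendsto S atTop (𝓝 (‖f‖ ^ 2)) := by
    have h := tendsto_two_pow_mul_integral_periodize (Φ := fun j => 𝓕 (φ j)) (𝓕 f) hlim hbd hf
    rw [Lp.norm_fourier_eq] at h
    refine h.congr' ?_
    obtain ⟨N, hN⟩ := pow_unbounded_of_one_lt (2 * R) (one_lt_two (α := ℝ))
    filter_upwards [eventually_ge_atTop N] with j hj
    have hL : 2 * R ≤ (1 : ℕ) * 2 ^ j := by
      rw [Nat.cast_one, one_mul]
      exact hN.le.trans (pow_le_pow_right₀ one_le_two hj)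
    exact (hasSum_sq_inner_shift j (hφ j) (hsupp 1 j hL)).tsum_eq.symm
  -- The partial sums of W telescope to S n - S 0.
  have hWsum : HasSum W (‖f‖ ^ 2 - S 0) := by
    rw [hasSum_iff_tendsto_nat_of_nonneg fun j => tsum_nonneg fun k => by positivity]
    refine (hlimS.sub_const (S 0)).congr fun n => ?_
    rw [← Finset.sum_range_sub S n]
    exact Finset.sum_congr rfl fun j _ => by rw [← hstep j]; ring
  have h := hasSum_sum_prod_of_nonneg (v := fun j k => ‖inner ℂ (shift (ψ j) j k) f‖ ^ 2)
    (fun j k => by positivity) (hS 0).hasSum (fun j => (hW j).hasSum) hWsum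
  rw [add_sub_cancel] at h
  refine Eq.mpr (congrArg (HasSum · _) (funext fun i => ?_)) h
  cases i <;> rfl

theorem mainTheorem3 (φ : ℕ → LTwo) (m₀ : ℕ → ℝ → ℂ)
    (hlim : ∀ᵐ ξ : ℝ, Tendsto
      (fun j : ℕ => (((2 : ℝ) ^ ((j : ℝ) / 2) : ℝ) : ℂ) * (𝓕 (φ j) : LTwo) ξ) atTop (𝓝 1))
    (hper : ∀ j : ℕ, 1 ≤ j → Function.Periodic (m₀ j) 1)
    (hmem : ∀ j : ℕ, 1 ≤ j → MemLp (m₀ j) 2 (volume.restrict (Set.Ico (0 : ℝ) 1)))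
    (hmask : ∀ j : ℕ, 1 ≤ j → ∀ᵐ ξ : ℝ, ‖m₀ j ξ‖ ^ 2 + ‖m₀ j (ξ + 1 / 2)‖ ^ 2 = 2)
    (href : ∀ j : ℕ, ∀ᵐ ξ : ℝ,
      (𝓕 (φ j) : LTwo) ξ = m₀ (j + 1) (ξ / 2 ^ (j + 1)) * (𝓕 (φ (j + 1)) : LTwo) ξ) :
    (∃! ψ : ℕ → LTwo, IsWaveletSequence φ m₀ ψ) ∧
      ∀ ψ : ℕ → LTwo, IsWaveletSequence φ m₀ ψ → IsParsevalFrame (waveletSystem (φ 0) ψ) := by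
  refine ⟨existsUnique_isWaveletSequence φ m₀ hper hmem hmask, fun ψ hψ => ?_⟩
  refine isParsevalFrame_of_dense _ dense_fourier_ae_eq_zero ?_
  rintro f ⟨R, hf⟩
  exact hasSum_waveletSystem_of_bandlimited hlim hper hmask href hψ hf
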